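/- For a complex $m\times n$ matrix $Z$ let $\|Z\|_\infty$ be its operator norm with respect to the Euclidean norms on $\mathbb C^n$ and $\mathbb C^m$, and let $X\circ Z$ denote the entrywise (Schur) product. The Schur multiplier norm of a complex $m\times n$ matrix $Y$ is $\|Y\|_S=\sup\{\|Y\circ Z\|_\infty : Z\in M_{(m,n)}(\mathbb C),\ \|Z\|_\infty\le 1\}$, and its dual norm is $$\|X\|_{cbB}=\sup\{|\mathrm{Tr}_n(Y^*X)| : Y\in M_{(m,n)}(\mathbb C),\ \|Y\|_S\le 1\},\qquad X\in M_{(m,n)}(\mathbb C).$$ For $\lambda\in\mathbb R^{k}$ let $\Delta(\lambda)$ be the $k\times k$ diagonal matrix with diagonal $\lambda$, and for self-adjoint matrices $A,B$ write $A\ge B$ if $A-B$ is positive semidefinite. **Theorem.** Let $X$ be a complex $m\times n$ matrix and let $Y=\begin{pmatrix}0&X\\X^*&0\end{pmatrix}\in M_{(m+n)}(\mathbb C)$. Then $$\|X\|_{cbB}=\tfrac12\min\{\mathrm{Tr}_{(m+n)}(\Delta(\lambda)) : \lambda\in\mathbb R^{m+n},\ \Delta(\lambda)\ge Y\},$$ where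 in particular the minimum is attained. -/

import Mathlib

open scoped Matrix Matrix.Norms.L2Operator MatrixOrder ComplexOrder

noncomputable section

namespace SchurDual

/-- The numbers `‖X ⊙ Z‖` with `‖Z‖ ≤ 1`, where `⊙` is the entrywise (Schur) product and `‖·‖`
is the operator norm of matrices between Euclidean spaces. -/
def schurSet {m n : Type*} [Fintype m] [Fintype n] [DecidableEq n] (X : Matrix m n ℂ) : Set ℝ :=
  {r | ∃ Z : Matrix m n ℂ, ‖Z‖ ≤ 1 ∧ r = ‖X ⊙ Z‖}

/-- The Schur multiplier norm `‖X‖_S`: the norm of the map `Z ↦ X ⊙ Z`. -/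
def schurNorm {m n : Type*} [Fintype m] [Fintype n] [DecidableEq n] (X : Matrix m n ℂ) : ℝ :=
  sSup (schurSet X)

/-- The supremum defining `‖X‖_S` is a genuine least upper bound. -/
theorem isLUB_schurNorm {m n : Type*} [Fintype m] [Fintype n] [DecidableEq n]
    (X : Matrix m n ℂ) : IsLUB (schurSet X) (schurNorm X) := by
  refine isLUB_csSup ⟨0, 0, by simp, by simp⟩ ?_
  let f : Matrix m n ℂ →ₗ[ℂ] Matrix m n ℂ :=
    { toFun := fun Z => X ⊙ Z
      map_add' := fun Z W => Matrix.hadamard_add X Z W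
      map_smul' := fun c Z => Matrix.hadamard_smul X Z c }
  let F := LinearMap.toContinuousLinearMap f
  refine ⟨‖F‖, ?_⟩
  rintro r ⟨Z, hZ, rfl⟩
  exact (F.le_opNorm Z).trans (mul_le_of_le_one_right (norm_nonneg _) hZ)

/-- The numbers `|Tr(Y* X)|` with `‖Y‖_S ≤ 1`. -/
def cbBSet {m n : Type*} [Fintype m] [Fintype n] [DecidableEq n] (X : Matrix m n ℂ) : Set ℝ :=
  {r | ∃ Y : Matrix m n ℂ, schurNorm Y ≤ 1 ∧ r = ‖(Yᴴ * X).trace‖}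

/-- The norm `‖X‖_cbB`, dual to the Schur multiplier norm under the pairing `Tr(Y* X)`. -/
def cbBNorm {m n : Type*} [Fintype m] [Fintype n] [DecidableEq n] (X : Matrix m n ℂ) : ℝ :=
  sSup (cbBSet X)

/-- The supremum defining `‖X‖_cbB` is a genuine least upper bound. -/
theorem isLUB_cbBNorm {m n : Type*} [Fintype m] [Fintype n] [DecidableEq n]
    (X : Matrix m n ℂ) : IsLUB (cbBSet X) (cbBNorm X) := by
  refine isLUB_csSup ⟨0, 0, ?_, by simp⟩ ?_
  · refine (isLUB_schurNorm (0 : Matrix m n ℂ)).2 ?_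
    rintro r ⟨Z, -, rfl⟩
    simp
  · let f : Matrix m n ℂ →ₗ[ℂ] ℂ :=
      { toFun := fun Y => (Xᴴ * Y).trace
        map_add' := fun Y Z => by simp [Matrix.mul_add]
        map_smul' := fun c Y => by simp }
    let F := LinearMap.toContinuousLinearMap f
    let J : Matrix m n ℂ := Matrix.of fun _ _ => 1
    refine ⟨‖F‖ * (‖J‖ + 1), ?_⟩
    rintro r ⟨Y, hY, rfl⟩
    have h1 : ‖(Yᴴ * X).trace‖ = ‖F Y‖ := by
      have : (Yᴴ * X).trace = star (F Y) := by
        change _ = star (Xᴴ * Y).trace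
        rw [← Matrix.trace_conjTranspose, Matrix.conjTranspose_mul,
          Matrix.conjTranspose_conjTranspose]
      rw [this, norm_star]
    have hJ : 0 < ‖J‖ + 1 := by positivity
    have hc : ‖((‖J‖ + 1 : ℝ) : ℂ)⁻¹‖ = (‖J‖ + 1)⁻¹ := by
      rw [norm_inv, Complex.norm_real, Real.norm_of_nonneg hJ.le]
    have h2 : (‖J‖ + 1)⁻¹ * ‖Y‖ ≤ 1 := by
      refine ((isLUB_schurNorm Y).1 ⟨((‖J‖ + 1 : ℝ) : ℂ)⁻¹ • J, ?_, ?_⟩).trans hY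
      · rw [norm_smul, hc, inv_mul_le_iff₀ hJ]
        linarith
      · have hYJ : Y ⊙ J = Y := by
          ext i j; simp [J]
        rw [Matrix.hadamard_smul, hYJ, norm_smul, hc]
    rw [inv_mul_le_iff₀ hJ, mul_one] at h2
    rw [h1]
    exact (F.le_opNorm Y).trans (mul_le_mul_of_nonneg_left h2 (norm_nonneg _))

/-- The self-adjoint block matrix `[[0, X], [X*, 0]]`. -/
def selfAdjointBlock {m n : Type*} (X : Matrix m n ℂ) : Matrix (m ⊕ n) (m ⊕ n) ℂ :=
  Matrix.fromBlocks 0 X Xᴴ 0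

/-- The diagonal matrix `Δ(γ)` of a real vector `γ`, as a complex matrix. -/
def realDiag {k : Type*} [DecidableEq k] (γ : k → ℝ) : Matrix k k ℂ :=
  Matrix.diagonal fun i => (γ i : ℂ)

end SchurDual

end

namespace SchurDual

/-! Read as a quadratic form, Δ(γ) ≥ [[0, X], [X*, 0]] bounds 2 Re⟨v, Xw⟩ by the γ-weighted squares
of v and w. For γ = 1 this says ‖X‖ ≤ 1, and passing to diag(v)* X diag(w) multiplies γ by |v|²,
|w|². So weighted domination and contractivity are exchanged by diagonal rescaling. Upper bound
(`re_trace_le_of_pos`): for γ > 0, rescaling the conjugate of X by γ^(-1/2) gives a contraction C;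
testing Y ⊙ C on √γ undoes the scaling and bounds 2 Re Tr(Y*X) by Σγ. Lower bound
(`minTrace_le_cbBNorm`): the minimal trace is sublinear, so Hahn–Banach gives a functional 2 Re
Tr(Y* ·) below it, touching it at X; testing on rescaled contractions gives ‖Y‖_S ≤ 1. -/

/-- The matrix `diag(v)* X diag(w)`, written entrywise. -/
noncomputable def scale {m n : Type*} (v : m → ℂ) (X : Matrix m n ℂ) (w : n → ℂ) : Matrix m n ℂ :=
  Matrix.of fun i j => star (v i) * X i j * w j

theorem scale_mulVec {m n : Type*} [Fintype n] (v : m → ℂ) (X : Matrix m n ℂ) (w q : n → ℂ) :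
    scale v X w *ᵥ q = star v * (X *ᵥ (w * q)) := by
  ext i
  simp [scale, Matrix.mulVec, dotProduct, Finset.mul_sum, mul_assoc]

variable {m n : Type*} [Fintype m] [Fintype n]

/-- The quadratic-form version of `selfAdjointBlock X ≤ realDiag γ`. -/
def DiagDominates (X : Matrix m n ℂ) (γ : m ⊕ n → ℝ) : Prop :=
  ∀ (v : m → ℂ) (w : n → ℂ), 2 * (star v ⬝ᵥ (X *ᵥ w)).re ≤
    ∑ i, γ (.inl i) * ‖v i‖ ^ 2 + ∑ j, γ (.inr j) * ‖w j‖ ^ 2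

theorem selfAdjointBlock_le_realDiag_iff [DecidableEq m] [DecidableEq n]
    {X : Matrix m n ℂ} {γ : m ⊕ n → ℝ} :
    selfAdjointBlock X ≤ realDiag γ ↔ DiagDominates X γ := by
  have hherm : (realDiag γ - selfAdjointBlock X).IsHermitian := by
    refine Matrix.IsHermitian.sub ?_ ?_
    · rw [realDiag, Matrix.isHermitian_diagonal_iff]
      intro i
      simp [isSelfAdjoint_iff]
    · exact Matrix.IsHermitian.fromBlocks Matrix.isHermitian_zero rfl Matrix.isHermitian_zero
  have key (v : m → ℂ) (w : n → ℂ) :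
      star (Sum.elim v w) ⬝ᵥ ((realDiag γ - selfAdjointBlock X) *ᵥ Sum.elim v w) =
        ((∑ i, γ (.inl i) * ‖v i‖ ^ 2 + ∑ j, γ (.inr j) * ‖w j‖ ^ 2
          - 2 * (star v ⬝ᵥ (X *ᵥ w)).re : ℝ) : ℂ) := by
    have hs : star (Sum.elim v w) = Sum.elim (star v) (star w) := by
      ext i; cases i <;> rfl
    have h1 : star (Sum.elim v w) ⬝ᵥ (realDiag γ *ᵥ Sum.elim v w) =
        ((∑ i, γ (.inl i) * ‖v i‖ ^ 2 + ∑ j, γ (.inr j) * ‖w j‖ ^ 2 : ℝ) : ℂ) := by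
      simp only [realDiag, dotProduct, Matrix.mulVec_diagonal, Fintype.sum_sum_type, Pi.star_apply,
        Sum.elim_inl, Sum.elim_inr]
      push_cast
      congr 1 <;> refine Finset.sum_congr rfl fun i _ => ?_ <;>
        rw [mul_left_comm, RCLike.star_def, Complex.conj_mul']
    have h2 : star w ⬝ᵥ (Xᴴ *ᵥ v) = star (star v ⬝ᵥ (X *ᵥ w)) := by
      rw [← Matrix.star_dotProduct_star, star_star, Matrix.star_mulVec, dotProduct_comm,
        ← Matrix.dotProduct_mulVec, dotProduct_comm]
    have h3 : star (Sum.elim v w) ⬝ᵥ (selfAdjointBlock X *ᵥ Sum.elim v w) =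
        ((2 * (star v ⬝ᵥ (X *ᵥ w)).re : ℝ) : ℂ) := by
      rw [hs, selfAdjointBlock, Matrix.fromBlocks_mulVec, sumElim_dotProduct_sumElim]
      simp only [Matrix.zero_mulVec, zero_add, add_zero, Sum.elim_comp_inl, Sum.elim_comp_inr]
      rw [h2, RCLike.star_def, Complex.add_conj]
    rw [Matrix.sub_mulVec, dotProduct_sub, h1, h3, ← Complex.ofReal_sub]
  rw [Matrix.le_iff, Matrix.posSemidef_iff_dotProduct_mulVec]
  constructor
  · rintro ⟨-, h⟩ v w
    have := h (Sum.elim v w)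
    rw [key, Complex.zero_le_real] at this
    linarith
  · refine fun h => ⟨hherm, fun x => ?_⟩
    have := h (x ∘ Sum.inl) (x ∘ Sum.inr)
    rw [← Sum.elim_comp_inl_inr x, key, Complex.zero_le_real]
    linarith

theorem sum_norm_sq_eq_norm_toLp_sq {k : Type*} [Fintype k] (v : k → ℂ) :
    ∑ i, ‖v i‖ ^ 2 = ‖WithLp.toLp 2 v‖ ^ 2 := by
  rw [EuclideanSpace.norm_sq_eq]

theorem norm_le_one_iff_diagDominates [DecidableEq n] {M : Matrix m n ℂ} :
    ‖M‖ ≤ 1 ↔ DiagDominates M 1 := by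
  have hinner (v u : m → ℂ) :
      star v ⬝ᵥ u = inner ℂ (WithLp.toLp 2 v) (WithLp.toLp 2 u) := by
    rw [EuclideanSpace.inner_eq_star_dotProduct, dotProduct_comm]
  simp only [DiagDominates, Pi.one_apply, one_mul]
  constructor
  · intro h v w
    have h1 := Matrix.l2_opNorm_mulVec M (WithLp.toLp 2 w)
    have h2 : ‖WithLp.toLp 2 (M *ᵥ w)‖ ≤ ‖WithLp.toLp 2 w‖ :=
      h1.trans (mul_le_of_le_one_left (norm_nonneg _) h)
    have h3 : (star v ⬝ᵥ (M *ᵥ w)).re ≤ ‖WithLp.toLp 2 v‖ * ‖WithLp.toLp 2 (M *ᵥ w)‖ := by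
      rw [hinner]
      exact (Complex.re_le_norm _).trans (norm_inner_le_norm _ _)
    rw [sum_norm_sq_eq_norm_toLp_sq, sum_norm_sq_eq_norm_toLp_sq]
    nlinarith [norm_nonneg (WithLp.toLp 2 v), norm_nonneg (WithLp.toLp 2 w),
      sq_nonneg (‖WithLp.toLp 2 v‖ - ‖WithLp.toLp 2 w‖),
      mul_le_mul_of_nonneg_left h2 (norm_nonneg (WithLp.toLp 2 v))]
  · intro h
    rw [Matrix.l2_opNorm_def]
    refine ContinuousLinearMap.opNorm_le_bound _ zero_le_one fun x => ?_
    change ‖WithLp.toLp 2 (M *ᵥ x.ofLp)‖ ≤ _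
    -- With v = Mx this reads 2‖Mx‖² ≤ ‖Mx‖² + ‖x‖².
    have h1 := h (M *ᵥ x.ofLp) x.ofLp
    rw [sum_norm_sq_eq_norm_toLp_sq, sum_norm_sq_eq_norm_toLp_sq, hinner,
      inner_self_eq_norm_sq_to_K] at h1
    norm_cast at h1
    rw [one_mul]
    refine le_of_sq_le_sq ?_ (norm_nonneg _)
    have h2 : ‖WithLp.toLp 2 x.ofLp‖ = ‖x‖ := rfl
    rw [h2] at h1
    have h3 := Complex.ofReal_re (‖WithLp.toLp 2 (M *ᵥ x.ofLp)‖ ^ 2)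
    erw [h3] at h1
    linarith

theorem DiagDominates.scale {X : Matrix m n ℂ} {γ : m ⊕ n → ℝ} (h : DiagDominates X γ)
    (v : m → ℂ) (w : n → ℂ) :
    DiagDominates (scale v X w)
      (Sum.elim (fun i => γ (.inl i) * ‖v i‖ ^ 2) (fun j => γ (.inr j) * ‖w j‖ ^ 2)) := by
  intro p q
  have h1 : star p ⬝ᵥ (SchurDual.scale v X w *ᵥ q) = star (v * p) ⬝ᵥ (X *ᵥ (w * q)) := by
    rw [scale_mulVec]
    simp only [dotProduct, Pi.star_apply, Pi.mul_apply, star_mul']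
    exact Finset.sum_congr rfl fun i _ => by ring
  rw [h1]
  refine (h _ _).trans_eq ?_
  simp [mul_pow, mul_assoc]

theorem DiagDominates.add {X X' : Matrix m n ℂ} {γ γ' : m ⊕ n → ℝ} (h : DiagDominates X γ)
    (h' : DiagDominates X' γ') : DiagDominates (X + X') (γ + γ') := by
  intro v w
  have h1 := h v w
  have h2 := h' v w
  simp only [Matrix.add_mulVec, dotProduct_add, Complex.add_re, Pi.add_apply, add_mul,
    Finset.sum_add_distrib]
  linarith

theorem DiagDominates.smul {X : Matrix m n ℂ} {γ : m ⊕ n → ℝ} (h : DiagDominates X γ)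
    {c : ℝ} (hc : 0 ≤ c) : DiagDominates (c • X) (c • γ) := by
  intro v w
  have h1 := mul_le_mul_of_nonneg_left (h v w) hc
  simp only [Matrix.smul_mulVec, dotProduct_smul, Complex.smul_re, Pi.smul_apply, smul_eq_mul,
    mul_assoc, ← Finset.mul_sum]
  linarith

theorem DiagDominates.mono {X : Matrix m n ℂ} {γ γ' : m ⊕ n → ℝ} (h : DiagDominates X γ)
    (hγ : γ ≤ γ') : DiagDominates X γ' := by
  intro v w
  refine (h v w).trans ?_
  gcongr <;> exact hγ _

theorem DiagDominates.map_star {X : Matrix m n ℂ} {γ : m ⊕ n → ℝ} (h : DiagDominates X γ) :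
    DiagDominates (X.map star) γ := by
  intro v w
  have h1 := h (star v) (star w)
  simp only [Pi.star_apply, norm_star] at h1
  refine le_trans (le_of_eq ?_) h1
  congr 1
  rw [← Complex.conj_re]
  congr 1
  simp [dotProduct, Matrix.mulVec, map_sum]

theorem DiagDominates.nonneg {X : Matrix m n ℂ} {γ : m ⊕ n → ℝ} (h : DiagDominates X γ) :
    0 ≤ γ := by
  classical
  rintro (i | j)
  · simpa [Pi.single_apply, apply_ite] using h (Pi.single i 1) 0
  · simpa [Pi.single_apply, apply_ite] using h 0 (Pi.single j 1)

theorem isClosed_diagDominates (X : Matrix m n ℂ) : IsClosed {γ | DiagDominates X γ} := by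
  simp only [DiagDominates, Set.ofPred_forall]
  refine isClosed_iInter fun v => isClosed_iInter fun w => isClosed_le ?_ ?_ <;> fun_prop

theorem exists_diagDominates (X : Matrix m n ℂ) : ∃ γ, DiagDominates X γ := by
  classical
  have hc : 0 < ‖X‖ + 1 := by positivity
  have h : ‖(‖X‖ + 1)⁻¹ • X‖ ≤ 1 := by
    rw [norm_smul, norm_inv, Real.norm_of_nonneg hc.le, inv_mul_le_iff₀ hc]
    linarith
  have h1 := (norm_le_one_iff_diagDominates.1 h).smul hc.le
  rw [smul_inv_smul₀ hc.ne'] at h1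
  exact ⟨_, h1⟩

/-! ### The minimal trace: attainment and sublinearity -/

/-- The traces of the diagonal matrices dominating `X`. -/
def traceSet (X : Matrix m n ℂ) : Set ℝ :=
  {s | ∃ γ, DiagDominates X γ ∧ s = ∑ k, γ k}

/-- The minimal trace of a diagonal matrix dominating `X`. -/
noncomputable def minTrace (X : Matrix m n ℂ) : ℝ := sInf (traceSet X)

theorem isLeast_minTrace (X : Matrix m n ℂ) : IsLeast (traceSet X) (minTrace X) := by
  obtain ⟨γ₀, h₀⟩ := exists_diagDominates X
  -- Dominating vectors are nonnegative, so a bound on the trace bounds every entry.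
  have hcomp : IsCompact ({γ | DiagDominates X γ} ∩ {γ | ∑ k, γ k ≤ ∑ k, γ₀ k}) := by
    refine (isCompact_Icc (a := (0 : m ⊕ n → ℝ)) (b := fun _ => ∑ k, γ₀ k)).of_isClosed_subset
      ((isClosed_diagDominates X).inter (isClosed_le (by fun_prop) continuous_const)) ?_
    rintro γ ⟨h, hs⟩
    exact ⟨h.nonneg, fun k =>
      (Finset.single_le_sum (fun i _ => h.nonneg i) (Finset.mem_univ k)).trans hs⟩
  obtain ⟨γ, ⟨hγ, hγs⟩, hmin⟩ := hcomp.exists_isMinOn ⟨γ₀, h₀, le_refl (∑ k, γ₀ k)⟩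
    (f := fun γ => ∑ k, γ k) (by fun_prop)
  have hleast : IsLeast (traceSet X) (∑ k, γ k) := by
    refine ⟨⟨γ, hγ, rfl⟩, ?_⟩
    rintro s ⟨γ', h', rfl⟩
    by_cases hle : ∑ k, γ' k ≤ ∑ k, γ₀ k
    · exact hmin ⟨h', hle⟩
    · exact hγs.trans (not_le.1 hle).le
  rw [minTrace, hleast.csInf_eq]
  exact hleast

theorem minTrace_le {X : Matrix m n ℂ} {γ : m ⊕ n → ℝ} (h : DiagDominates X γ) :
    minTrace X ≤ ∑ k, γ k :=
  (isLeast_minTrace X).2 ⟨γ, h, rfl⟩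

theorem minTrace_nonneg (X : Matrix m n ℂ) : 0 ≤ minTrace X := by
  obtain ⟨γ, h, hs⟩ := (isLeast_minTrace X).1
  rw [hs]
  exact Finset.sum_nonneg fun k _ => h.nonneg k

theorem minTrace_add_le (X X' : Matrix m n ℂ) :
    minTrace (X + X') ≤ minTrace X + minTrace X' := by
  obtain ⟨γ, h, hs⟩ := (isLeast_minTrace X).1
  obtain ⟨γ', h', hs'⟩ := (isLeast_minTrace X').1
  rw [hs, hs', ← Finset.sum_add_distrib]
  exact minTrace_le (h.add h')

theorem minTrace_smul {c : ℝ} (hc : 0 < c) (X : Matrix m n ℂ) :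
    minTrace (c • X) = c * minTrace X := by
  have key {c : ℝ} (hc : 0 < c) (X : Matrix m n ℂ) : minTrace (c • X) ≤ c * minTrace X := by
    obtain ⟨γ, h, hs⟩ := (isLeast_minTrace X).1
    rw [hs, Finset.mul_sum]
    exact minTrace_le (h.smul hc.le)
  refine (key hc X).antisymm ?_
  have h1 := key (inv_pos.2 hc) (c • X)
  rwa [inv_smul_smul₀ hc.ne', le_inv_mul_iff₀ hc] at h1

/-! ### Lower bound by Hahn–Banach -/

theorem trace_conjTranspose_mul (Y X : Matrix m n ℂ) :
    (Yᴴ * X).trace = ∑ i, ∑ j, star (Y i j) * X i j := by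
  rw [Finset.sum_comm]
  rfl

theorem exists_linearMap_minTrace (X : Matrix m n ℂ) :
    ∃ g : Matrix m n ℂ →ₗ[ℝ] ℝ, g X = minTrace X ∧ ∀ A, g A ≤ minTrace A := by
  rcases eq_or_ne X 0 with rfl | hX
  · refine ⟨0, ?_, fun A => minTrace_nonneg A⟩
    have := minTrace_smul two_pos (0 : Matrix m n ℂ)
    rw [smul_zero] at this
    rw [LinearMap.zero_apply]
    linarith
  obtain ⟨g, h1, h2⟩ := exists_extension_of_le_sublinear
    (LinearPMap.mkSpanSingleton X (minTrace X) hX) minTrace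
    (fun c hc A => minTrace_smul hc A) minTrace_add_le (by
      rintro ⟨x, hx⟩
      obtain ⟨c, rfl⟩ := Submodule.mem_span_singleton.1 hx
      rw [LinearPMap.mkSpanSingleton'_apply, smul_eq_mul]
      -- Homogeneity covers only c > 0; otherwise nonnegativity of the minimal trace suffices.
      rcases lt_or_ge 0 c with hc | hc
      · exact (minTrace_smul hc X).ge
      · exact (mul_nonpos_of_nonpos_of_nonneg hc (minTrace_nonneg X)).trans (minTrace_nonneg _))
  refine ⟨g, ?_, h2⟩
  have := h1 ⟨X, Submodule.mem_span_singleton_self X⟩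
  rw [this]
  exact LinearPMap.mkSpanSingleton_apply ℝ ℝ hX (minTrace X)

theorem exists_re_trace_eq (g : Matrix m n ℂ →ₗ[ℝ] ℝ) :
    ∃ Y : Matrix m n ℂ, ∀ A, g A = (Yᴴ * A).trace.re := by
  classical
  refine ⟨Matrix.of fun i j => ⟨g (Matrix.single i j 1), g (Matrix.single i j Complex.I)⟩,
    fun A => ?_⟩
  conv_lhs => rw [Matrix.matrix_eq_sum_single A]
  simp only [trace_conjTranspose_mul, map_sum, Complex.re_sum]
  refine Finset.sum_congr rfl fun i _ => Finset.sum_congr rfl fun j _ => ?_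
  have h : Matrix.single i j (A i j) =
      (A i j).re • Matrix.single i j (1 : ℂ) + (A i j).im • Matrix.single i j Complex.I := by
    rw [Matrix.smul_single, Matrix.smul_single, ← Matrix.single_add]
    congr 1
    simp
  rw [h, map_add, map_smul, map_smul]
  simp [mul_comm]

/-- For a contraction Z, the matrix A with entries v_i · conj(Z_ij) · conj(w_j) has minimal trace at
most ‖v‖² + ‖w‖², while Tr(Y*A) is the conjugate of ⟨v, (Y ⊙ Z)w⟩. -/
theorem schurNorm_le_one_of_re_trace_le [DecidableEq n] {Y : Matrix m n ℂ}
    (hY : ∀ A : Matrix m n ℂ, 2 * (Yᴴ * A).trace.re ≤ minTrace A) : schurNorm Y ≤ 1 := by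
  refine (isLUB_schurNorm Y).2 ?_
  rintro r ⟨Z, hZ, rfl⟩
  rw [norm_le_one_iff_diagDominates]
  intro v w
  have h1 := (norm_le_one_iff_diagDominates.1 hZ).map_star.scale (star v) (star w)
  have h2 := (hY _).trans (minTrace_le h1)
  simp only [Fintype.sum_sum_type, Sum.elim_inl, Sum.elim_inr, Pi.star_apply, norm_star] at h2
  refine le_trans (le_of_eq ?_) h2
  congr 1
  rw [← Complex.conj_re]
  congr 1
  rw [trace_conjTranspose_mul]
  simp only [dotProduct, Matrix.mulVec, map_sum, Finset.mul_sum, scale]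
  refine Finset.sum_congr rfl fun i _ => Finset.sum_congr rfl fun j _ => ?_
  simp
  ring

theorem minTrace_le_cbBNorm [DecidableEq n] (X : Matrix m n ℂ) :
    minTrace X ≤ 2 * cbBNorm X := by
  obtain ⟨g, hgX, hg⟩ := exists_linearMap_minTrace X
  obtain ⟨Y, hY⟩ := exists_re_trace_eq ((2⁻¹ : ℝ) • g)
  simp only [LinearMap.smul_apply, smul_eq_mul] at hY
  have h1 : schurNorm Y ≤ 1 := schurNorm_le_one_of_re_trace_le fun A => by
    rw [← hY]
    linarith [hg A]
  have h2 := (isLUB_cbBNorm X).1 ⟨Y, h1, rfl⟩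
  have h3 := Complex.re_le_norm (Yᴴ * X).trace
  rw [← hY, hgX] at h3
  linarith

/-! ### Upper bound by rescaling -/

theorem re_trace_le_of_pos [DecidableEq n] {X Y : Matrix m n ℂ} {γ : m ⊕ n → ℝ}
    (hX : DiagDominates X γ) (hγ : ∀ k, 0 < γ k) (hY : schurNorm Y ≤ 1) :
    2 * (Yᴴ * X).trace.re ≤ ∑ k, γ k := by
  let r : m ⊕ n → ℂ := fun k => ((√(γ k) : ℝ) : ℂ)
  have hr (k) : r k ≠ 0 := by simpa [r] using (Real.sqrt_pos.2 (hγ k)).ne'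
  have hrn (k) : ‖r k‖ ^ 2 = γ k := by
    simp [r, Real.sq_sqrt (hγ k).le]
  have hrs (k) : star (r k) = r k := by simp [r]
  set C := scale (fun i => (r (.inl i))⁻¹) (X.map star) (fun j => (r (.inr j))⁻¹) with hC
  have hC1 : ‖C‖ ≤ 1 := by
    rw [norm_le_one_iff_diagDominates]
    refine (hX.map_star.scale _ _).mono ?_
    rintro (i | j) <;> simp only [Sum.elim_inl, Sum.elim_inr, norm_inv, inv_pow, hrn] <;>
      exact (mul_inv_cancel₀ (hγ _).ne').le
  have h1 := ((isLUB_schurNorm Y).1 ⟨C, hC1, rfl⟩).trans hY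
  have h2 := norm_le_one_iff_diagDominates.1 h1 (fun i => r (.inl i)) (fun j => r (.inr j))
  simp only [hrn, Pi.one_apply, one_mul] at h2
  rw [Fintype.sum_sum_type]
  refine le_trans (le_of_eq ?_) h2
  congr 1
  rw [← Complex.conj_re]
  congr 1
  rw [trace_conjTranspose_mul]
  simp only [dotProduct, Matrix.mulVec, map_sum, Finset.mul_sum]
  refine Finset.sum_congr rfl fun i _ => Finset.sum_congr rfl fun j _ => ?_
  have hi := hr (.inl i)
  have hj := hr (.inr j)
  simp only [hC, scale, Matrix.hadamard_apply, Matrix.of_apply, Matrix.map_apply, star_inv₀, hrs,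
    Pi.star_apply, map_mul, RCLike.star_def, Complex.conj_conj]
  field_simp

theorem re_trace_le [DecidableEq n] {X Y : Matrix m n ℂ} {γ : m ⊕ n → ℝ}
    (hX : DiagDominates X γ) (hY : schurNorm Y ≤ 1) :
    2 * (Yᴴ * X).trace.re ≤ ∑ k, γ k := by
  -- Entries of γ may vanish, so γ^(-1/2) is made sense of by using γ + ε and letting ε → 0.
  have htend : Filter.Tendsto (fun ε : ℝ => ∑ k, (γ k + ε)) (nhdsWithin 0 (Set.Ioi 0))
      (nhds (∑ k, γ k)) := by
    have : Continuous fun ε : ℝ => ∑ k, (γ k + ε) := by fun_prop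
    simpa using (this.tendsto 0).mono_left nhdsWithin_le_nhds
  refine ge_of_tendsto htend ?_
  filter_upwards [self_mem_nhdsWithin] with ε hε
  have hε' : 0 < ε := hε
  exact re_trace_le_of_pos (hX.mono fun k => by simpa using hε'.le)
    (fun k => add_pos_of_nonneg_of_pos (hX.nonneg k) hε') hY

theorem norm_trace_le [DecidableEq n] {X Y : Matrix m n ℂ} {γ : m ⊕ n → ℝ}
    (hX : DiagDominates X γ) (hY : schurNorm Y ≤ 1) :
    2 * ‖(Yᴴ * X).trace‖ ≤ ∑ k, γ k := by
  obtain ⟨u, hu, hz⟩ : ∃ u : ℂ, ‖u‖ = 1 ∧ ((‖(Yᴴ * X).trace‖ : ℝ) : ℂ) = u * (Yᴴ * X).trace :=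
    RCLike.exists_norm_eq_mul_self (K := ℂ) _
  -- A unimodular factor leaves domination unchanged, so the real part upgrades to the modulus.
  have h1 : DiagDominates (u • X) γ := by
    have := hX.scale (fun _ => 1) (fun _ => u)
    simp only [hu, norm_one, one_pow, mul_one] at this
    have e1 : scale (fun _ => 1) X (fun _ => u) = u • X := by
      ext i j
      simp [scale, mul_comm]
    have e2 : Sum.elim (fun i => γ (.inl i)) (fun j => γ (.inr j)) = γ := by
      ext (i | j) <;> rfl
    rwa [e1, e2] at this
  have h2 := re_trace_le h1 hY
  rwa [Matrix.mul_smul, Matrix.trace_smul, smul_eq_mul, ← hz, Complex.ofReal_re] at h2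

theorem cbBNorm_eq_half_minTrace [DecidableEq n] (X : Matrix m n ℂ) :
    cbBNorm X = 1 / 2 * minTrace X := by
  refine le_antisymm ?_ (by linarith [minTrace_le_cbBNorm X])
  obtain ⟨γ, hγ, hs⟩ := (isLeast_minTrace X).1
  refine (isLUB_cbBNorm X).2 ?_
  rintro r ⟨Y, hY, rfl⟩
  linarith [norm_trace_le hγ hY]

theorem ofReal_eq_trace_realDiag_iff {k : Type*} [Fintype k] [DecidableEq k] {s : ℝ} {γ : k → ℝ} :
    (s : ℂ) = (realDiag γ).trace ↔ s = ∑ i, γ i := by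
  rw [realDiag, Matrix.trace_diagonal]
  norm_cast

end SchurDual

theorem theorem3p4 (m n : ℕ) (X : Matrix (Fin m) (Fin n) ℂ) :
    ∃ t : ℝ,
      IsLeast {s : ℝ | ∃ γ : Fin m ⊕ Fin n → ℝ,
        SchurDual.selfAdjointBlock X ≤ SchurDual.realDiag γ ∧
          (s : ℂ) = (SchurDual.realDiag γ).trace} t ∧
      SchurDual.cbBNorm X = 1 / 2 * t := by
  refine ⟨SchurDual.minTrace X, ?_, SchurDual.cbBNorm_eq_half_minTrace X⟩
  simp only [SchurDual.selfAdjointBlock_le_realDiag_iff, SchurDual.ofReal_eq_trace_realDiag_iff]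
  exact SchurDual.isLeast_minTrace X
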